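/- Let $\alpha>1$. There exists a constant $C<\infty$, depending only on $\alpha$, such that the following holds. Let $(\mathcal X,\mathbb P)$ be a probability space, let $\mathsf T:\mathcal X\to\mathcal X$ be a measurable map that preserves $\mathbb P$ (not necessarily invertible), and let $P g:=g\circ\mathsf T$ be the associated transition operator on the real Hilbert space $L^2(\mathbb P)$, with scalar product $\langle g,h\rangle=\int gh\,\mathrm d\mathbb P$. Put $\mathcal L:=\mathrm{Id}-P$, and let $\mathcal L^*$ be the adjoint of $\mathcal L$ in $L^2(\mathbb P)$. Let $f\in L^2(\mathbb P)$ satisfy $$|\langle f,P^kf\rangle|\le(1+k)^{-\alpha}\qquad\text{for every integer }k\ge0 .$$ For a sequence $(\mu_k)_{k\ge0}$ in $(0,1]$, define $f_{-1}=f_{-1}^*:=f$ and, for every integer $k\ge0$, $$f_k:=\mu_k(\mu_k+\mathcal L)^{-1}f_{k-1},\qquad f_k^*:=\mu_k(\mu_k+\mathcal L^*)^{-1}f_{k-1}^* .$$ If $\mu_k=1$ for every $k\ge0$, then for every integer $k\ge0$, $$|\langle f_k^*,f_k^*\rangle|+|\langle f_k,f_k\rangle|\le C(1+k)^{-1/2}.$$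 If instead $\mu_k=2^{-k}$ for every $k\ge0$, then for every integer $k\ge0$, $$|\langle f_k^*,f_k^*\rangle|+|\langle f_k,f_k\rangle|\le C\,2^{-k}.$$ -/

import Mathlib

open MeasureTheory

namespace DynSys

noncomputable section

/-- The transition operator `P f = f ∘ T` on the real Hilbert space `L²(ℙ)` of the dynamical system
`X_n = T^n (X_0)`, where `T` preserves `ℙ`. -/
def transition {X : Type*} [MeasurableSpace X] {ℙ : Measure X} (T : X → X)
    (hT : MeasurePreserving T ℙ ℙ) : Lp ℝ 2 ℙ →L[ℝ] Lp ℝ 2 ℙ :=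
  (Lp.compMeasurePreservingₗᵢ ℝ T hT).toContinuousLinearMap

/-- The (sign-reversed) generator `ℒ = Id - P` of the dynamical system. -/
def generator {X : Type*} [MeasurableSpace X] {ℙ : Measure X} (T : X → X)
    (hT : MeasurePreserving T ℙ ℙ) : Lp ℝ 2 ℙ →L[ℝ] Lp ℝ 2 ℙ :=
  1 - transition T hT

/-- The resolvent `(m + A)⁻¹` of a bounded operator `A`; it is the two-sided inverse whenever
`m + A` is invertible, which is proved below for the operators that are used. -/
def resolvent {H : Type*} [NormedAddCommGroup H] [InnerProductSpace ℝ H]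
    (A : H →L[ℝ] H) (m : ℝ) : H →L[ℝ] H :=
  Ring.inverse (m • (1 : H →L[ℝ] H) + A)

/-- The functions `f_k`, `k = 0, 1, 2, …`, given by `f_{-1} = f` and
`f_k = μ_k (μ_k + A)⁻¹ f_{k-1}`. -/
def iter {H : Type*} [NormedAddCommGroup H] [InnerProductSpace ℝ H]
    (A : H →L[ℝ] H) (μ : ℕ → ℝ) (f : H) : ℕ → H
  | 0 => μ 0 • resolvent A (μ 0) f
  | k + 1 => μ (k + 1) • resolvent A (μ (k + 1)) (iter A μ f k)

theorem transition_ae {X : Type*} [MeasurableSpace X] {ℙ : Measure X} (T : X → X)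
    (hT : MeasurePreserving T ℙ ℙ) (f : Lp ℝ 2 ℙ) : transition T hT f =ᵐ[ℙ] f ∘ T :=
  Lp.coeFn_compMeasurePreserving f hT

theorem isUnit_of_contraction {H : Type*} [NormedAddCommGroup H] [InnerProductSpace ℝ H]
    [CompleteSpace H] (Q : H →L[ℝ] H) (hQ : ‖Q‖ ≤ 1) {m : ℝ} (hm : 0 < m) :
    IsUnit (m • (1 : H →L[ℝ] H) + (1 - Q)) := by
  have h1 : (0 : ℝ) < m + 1 := by linarith
  have h : m • (1 : H →L[ℝ] H) + (1 - Q) = (m + 1) • (1 - (m + 1)⁻¹ • Q) := by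
    rw [smul_sub, smul_inv_smul₀ h1.ne', add_smul, one_smul]
    abel
  have hn : ‖(m + 1)⁻¹ • Q‖ < 1 := by
    rw [norm_smul, Real.norm_of_nonneg (inv_nonneg.2 h1.le), inv_mul_lt_iff₀ h1]
    linarith
  rw [h]
  exact (isUnit_one_sub_of_norm_lt_one hn).smul (Units.mk0 (m + 1) h1.ne')

theorem norm_transition_le {X : Type*} [MeasurableSpace X] {ℙ : Measure X} (T : X → X)
    (hT : MeasurePreserving T ℙ ℙ) : ‖transition T hT‖ ≤ 1 := by
  refine ContinuousLinearMap.opNorm_le_bound _ zero_le_one fun f => ?_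
  rw [one_mul]
  exact ((Lp.compMeasurePreservingₗᵢ ℝ T hT).norm_map f).le

/-- `m + ℒ` is invertible for every `m > 0`. -/
theorem isUnit_add_generator {X : Type*} [MeasurableSpace X] {ℙ : Measure X} (T : X → X)
    (hT : MeasurePreserving T ℙ ℙ) {m : ℝ} (hm : 0 < m) :
    IsUnit (m • (1 : Lp ℝ 2 ℙ →L[ℝ] Lp ℝ 2 ℙ) + generator T hT) :=
  isUnit_of_contraction _ (norm_transition_le T hT) hm

/-- `m + ℒ*` is invertible for every `m > 0`. -/
theorem isUnit_add_adjoint_generator {X : Type*} [MeasurableSpace X] {ℙ : Measure X} (T : X → X)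
    (hT : MeasurePreserving T ℙ ℙ) {m : ℝ} (hm : 0 < m) :
    IsUnit (m • (1 : Lp ℝ 2 ℙ →L[ℝ] Lp ℝ 2 ℙ) +
      ContinuousLinearMap.adjoint (generator T hT)) := by
  have h : ContinuousLinearMap.adjoint (generator T hT)
      = 1 - ContinuousLinearMap.adjoint (transition T hT) := by
    simp only [generator, ← ContinuousLinearMap.star_eq_adjoint, star_sub, star_one]
  rw [h]
  refine isUnit_of_contraction _ ?_ hm
  rw [LinearIsometryEquiv.norm_map]
  exact norm_transition_le T hT

end

end DynSys

/-! Expanding each resolvent in powers of `P` gives `f_k = ∑ p n • P ^ n f`, where `p = iterWeight μ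
k` is the law of a sum of `k + 1` independent geometric variables. As `P` is an isometry, `⟨P ^ n f,
P ^ m f⟩` is bounded by `a |n - m|` with `a` summable, so `‖f_k‖²` is at most `sup p` times `2 ∑ a`
(`IsSubprobability.norm_sum_smul_sq_le`). The rates are bounds on `sup p`: the last geometric factor
alone gives `μ k` (`iterWeight_le`); for unit steps `p` is negative binomial, and a central binomial
estimate gives `(1 + k) ^ (-1/2)` (`iterWeight_one_le`). The adjoint is only a contraction;
`norm_iter_adjoint_sq_le` reduces it to powers of `P`. -/

namespace DynSys

open Finset

noncomputable section

/-! ### Weights of the power series -/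

/-- The coefficients of `μ (μ + 1 - z)⁻¹ p(z)`, where `p(z) = ∑ p n z ^ n`. -/
def resolventStep (μ : ℝ) (p : ℕ → ℝ) : ℕ → ℝ
  | 0 => μ * p 0 / (μ + 1)
  | n + 1 => (μ * p (n + 1) + resolventStep μ p n) / (μ + 1)

/-- The coefficients of the power series in `Q` that represents `iter (1 - Q) μ`. -/
def iterWeight (μ : ℕ → ℝ) : ℕ → ℕ → ℝ
  | 0 => resolventStep (μ 0) (Pi.single 0 1)
  | k + 1 => resolventStep (μ (k + 1)) (iterWeight μ k)

/-- A nonnegative sequence of total mass at most one. -/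
structure IsSubprobability (p : ℕ → ℝ) : Prop where
  nonneg : ∀ n, 0 ≤ p n
  sum_le : ∀ n, ∑ i ∈ range n, p i ≤ 1

theorem IsSubprobability.single : IsSubprobability (Pi.single 0 1) where
  nonneg n := by
    rcases eq_or_ne n 0 with rfl | h
    · simp
    · simp [h]
  sum_le n := by
    rcases n with _ | n
    · simp
    · rw [sum_range_succ']
      simp

theorem IsSubprobability.summable {p : ℕ → ℝ} (hp : IsSubprobability p) : Summable p :=
  summable_of_sum_range_le hp.nonneg hp.sum_le

theorem resolventStep_nonneg {μ : ℝ} (hμ : 0 < μ) {p : ℕ → ℝ} (hp : ∀ n, 0 ≤ p n) (n : ℕ) :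
    0 ≤ resolventStep μ p n := by
  induction n with
  | zero => have := hp 0; simp only [resolventStep]; positivity
  | succ n ih => have := hp (n + 1); simp only [resolventStep]; positivity

theorem resolventStep_zero_eq {μ : ℝ} (hμ : 0 < μ) (p : ℕ → ℝ) :
    (μ + 1) * resolventStep μ p 0 = μ * p 0 := by
  simp only [resolventStep]
  field_simp

theorem resolventStep_succ_eq {μ : ℝ} (hμ : 0 < μ) (p : ℕ → ℝ) (n : ℕ) :
    (μ + 1) * resolventStep μ p (n + 1) = μ * p (n + 1) + resolventStep μ p n := by
  simp only [resolventStep]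
  field_simp

/-- The recursion telescopes. Dropping either term on the left gives one of the two bounds: on the
total mass, or on a single weight. -/
theorem sum_resolventStep {μ : ℝ} (hμ : 0 < μ) (p : ℕ → ℝ) (n : ℕ) :
    μ * ∑ i ∈ range (n + 1), resolventStep μ p i + resolventStep μ p n
      = μ * ∑ i ∈ range (n + 1), p i := by
  induction n with
  | zero =>
    simp only [zero_add, sum_range_one]
    linarith [resolventStep_zero_eq hμ p]
  | succ n ih =>
    rw [sum_range_succ, sum_range_succ p (n + 1)]
    linarith [resolventStep_succ_eq hμ p n]

theorem IsSubprobability.resolventStep {μ : ℝ} (hμ : 0 < μ) {p : ℕ → ℝ}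
    (hp : IsSubprobability p) : IsSubprobability (resolventStep μ p) where
  nonneg := resolventStep_nonneg hμ hp.nonneg
  sum_le n := by
    rcases n with _ | n
    · simp
    · refine le_trans (le_of_mul_le_mul_left ?_ hμ) (hp.sum_le (n + 1))
      linarith [sum_resolventStep hμ p n, resolventStep_nonneg hμ hp.nonneg n]

theorem IsSubprobability.resolventStep_le {μ : ℝ} (hμ : 0 < μ) {p : ℕ → ℝ}
    (hp : IsSubprobability p) (n : ℕ) : DynSys.resolventStep μ p n ≤ μ := by
  have h1 := sum_resolventStep hμ p n
  have h2 : 0 ≤ ∑ i ∈ range (n + 1), DynSys.resolventStep μ p i :=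
    sum_nonneg fun i _ => resolventStep_nonneg hμ hp.nonneg i
  nlinarith [hp.sum_le (n + 1)]

theorem isSubprobability_iterWeight {μ : ℕ → ℝ} (hμ : ∀ k, 0 < μ k) (k : ℕ) :
    IsSubprobability (iterWeight μ k) := by
  induction k with
  | zero => exact IsSubprobability.single.resolventStep (hμ 0)
  | succ k ih => exact ih.resolventStep (hμ (k + 1))

theorem iterWeight_le {μ : ℕ → ℝ} (hμ : ∀ k, 0 < μ k) (k n : ℕ) : iterWeight μ k n ≤ μ k := by
  cases k with
  | zero => exact IsSubprobability.single.resolventStep_le (hμ 0) n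
  | succ k => exact (isSubprobability_iterWeight hμ k).resolventStep_le (hμ (k + 1)) n

/-- For unit steps the weights are those of a negative binomial distribution. -/
theorem iterWeight_one (k n : ℕ) :
    iterWeight (fun _ => 1) k n = ((n + k).choose k : ℝ) / 2 ^ (n + k + 1) := by
  induction k generalizing n with
  | zero =>
    induction n with
    | zero => norm_num [iterWeight, resolventStep]
    | succ n ih =>
      have h := resolventStep_succ_eq one_pos (Pi.single 0 1) n
      simp only [iterWeight] at ih ⊢
      rw [ih] at h
      simp only [Nat.choose_zero_right, add_zero, ne_eq, Nat.add_eq_zero_iff, one_ne_zero,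
        and_false, not_false_eq_true, Pi.single_eq_of_ne] at h ⊢
      rw [pow_succ, ← div_div]
      push_cast at h ⊢
      linarith
  | succ k ihk =>
    induction n with
    | zero =>
      have h := resolventStep_zero_eq one_pos (iterWeight (fun _ => 1) k)
      rw [ihk] at h
      simp only [iterWeight]
      simp only [zero_add, Nat.choose_self] at h ⊢
      rw [pow_succ, ← div_div]
      push_cast at h ⊢
      linarith
    | succ n ih =>
      have h := resolventStep_succ_eq one_pos (iterWeight (fun _ => 1) k) n
      simp only [iterWeight] at ih ⊢
      rw [ihk, ih] at h
      have e : n + 1 + (k + 1) = (n + 1 + k) + 1 := by ring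
      have e' : n + (k + 1) = n + 1 + k := by ring
      rw [e'] at h
      -- For `μ = 1` the recursion is Pascal's rule.
      rw [e, Nat.choose_succ_succ', pow_succ, ← div_div]
      push_cast at h ⊢
      rw [add_div]
      linarith

/-! ### Size of the negative binomial weights -/

theorem two_mul_add_one_mul_centralBinom_sq_le (n : ℕ) :
    (2 * n + 1) * n.centralBinom ^ 2 ≤ 16 ^ n := by
  induction n with
  | zero => simp
  | succ n ih =>
    have h := Nat.succ_mul_centralBinom_succ n
    refine Nat.le_of_mul_le_mul_left (c := (n + 1) ^ 2) ?_ (by positivity)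
    calc (n + 1) ^ 2 * ((2 * (n + 1) + 1) * (n + 1).centralBinom ^ 2)
        = (2 * n + 3) * ((n + 1) * (n + 1).centralBinom) ^ 2 := by ring
      _ = 4 * ((2 * n + 3) * (2 * n + 1)) * ((2 * n + 1) * n.centralBinom ^ 2) := by
        rw [h]; ring
      _ ≤ 4 * (4 * (n + 1) ^ 2) * 16 ^ n := by
        have h4 : (2 * n + 3) * (2 * n + 1) ≤ 4 * (n + 1) ^ 2 := by nlinarith
        gcongr
      _ = (n + 1) ^ 2 * 16 ^ (n + 1) := by ring

theorem succ_mul_choose_sq_le (n r : ℕ) : (n + 1) * n.choose r ^ 2 ≤ 4 ^ n := by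
  rcases Nat.even_or_odd' n with ⟨m, rfl | rfl⟩
  · calc (2 * m + 1) * (2 * m).choose r ^ 2 ≤ (2 * m + 1) * m.centralBinom ^ 2 := by
          gcongr; exact Nat.choose_le_centralBinom r m
      _ ≤ 16 ^ m := two_mul_add_one_mul_centralBinom_sq_le m
      _ = 4 ^ (2 * m) := by rw [pow_mul]; norm_num
  · have hmid : (2 * m + 1).choose r ≤ (2 * m + 1).choose m := by
      have := Nat.choose_le_middle r (2 * m + 1)
      rwa [show (2 * m + 1) / 2 = m by omega] at this
    -- An odd row's middle entry is half the next central binomial coefficient.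
    have hc : (m + 1).centralBinom = 2 * (2 * m + 1).choose m := by
      rw [Nat.centralBinom_eq_two_mul_choose, show 2 * (m + 1) = 2 * m + 1 + 1 by ring,
        Nat.choose_succ_succ', Nat.choose_symm_half]
      ring
    have h := two_mul_add_one_mul_centralBinom_sq_le (m + 1)
    rw [hc] at h
    have h4 : 4 * 4 ^ (2 * m + 1) = 16 ^ (m + 1) := by
      rw [← pow_succ', show 2 * m + 1 + 1 = 2 * (m + 1) by ring, pow_mul]; norm_num
    have hsq : (2 * m + 1).choose r ^ 2 ≤ (2 * m + 1).choose m ^ 2 := by gcongr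
    nlinarith

theorem iterWeight_one_le (k n : ℕ) :
    iterWeight (fun _ => 1) k n ≤ (1 + (k : ℝ)) ^ (-(1 / 2) : ℝ) := by
  have hk : (0 : ℝ) < 1 + k := by positivity
  have h : ((n + k : ℕ) + 1 : ℝ) * ((n + k).choose k : ℝ) ^ 2 ≤ 4 ^ (n + k) := by
    exact_mod_cast succ_mul_choose_sq_le (n + k) k
  rw [iterWeight_one, Real.rpow_neg hk.le, ← Real.sqrt_eq_rpow, div_le_iff₀ (by positivity),
    inv_mul_eq_div, le_div_iff₀ (Real.sqrt_pos.2 hk)]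
  refine le_of_sq_le_sq ?_ (by positivity)
  rw [mul_pow, Real.sq_sqrt hk.le]
  have h4 : ((2 : ℝ) ^ (n + k + 1)) ^ 2 = 4 * 4 ^ (n + k) := by
    rw [← pow_mul, mul_comm, pow_mul]; norm_num; ring
  have hp : (0 : ℝ) < 4 ^ (n + k) := by positivity
  push_cast at h
  nlinarith [sq_nonneg ((n + k).choose k : ℝ), mul_nonneg (Nat.cast_nonneg (α := ℝ) n)
    (sq_nonneg ((n + k).choose k : ℝ))]

/-! ### Series in powers of a contraction or an isometry -/

section Hilbert

variable {H : Type*} [NormedAddCommGroup H] [InnerProductSpace ℝ H]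

theorem norm_pow_apply_le {Q : H →L[ℝ] H} (hQ : ‖Q‖ ≤ 1) (n : ℕ) (f : H) :
    ‖(Q ^ n) f‖ ≤ ‖f‖ := by
  induction n with
  | zero => simp
  | succ n ih =>
    rw [pow_succ', mul_apply_eq_comp]
    exact (Q.le_of_opNorm_le hQ _).trans (by rwa [one_mul])

/-- Each distance from `n` occurs at most once on either side of `n`. -/
theorem sum_dist_le {a : ℕ → ℝ} (ha : ∀ n, 0 ≤ a n) (hs : Summable a) (n N : ℕ) :
    ∑ m ∈ range N, a (Nat.dist n m) ≤ 2 * ∑' j, a j := by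
  rw [← sum_filter_add_sum_filter_not (range N) (· ≤ n), two_mul]
  refine add_le_add ?_ ?_
  · rw [← sum_image (f := a) (g := Nat.dist n)]
    · exact hs.sum_le_tsum _ fun i _ => ha i
    · intro x hx y hy hxy
      simp only [coe_filter, Set.mem_ofPred_eq] at hx hy
      simp only [Nat.dist] at hxy
      omega
  · rw [← sum_image (f := a) (g := Nat.dist n)]
    · exact hs.sum_le_tsum _ fun i _ => ha i
    · intro x hx y hy hxy
      simp only [coe_filter, Set.mem_ofPred_eq] at hx hy
      simp only [Nat.dist] at hxy
      omega

/-- In the double sum one weight is bounded by its supremum `M`; the other is summed, with mass at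
most one. -/
theorem IsSubprobability.norm_sum_smul_sq_le {p : ℕ → ℝ} (hp : IsSubprobability p) {M : ℝ}
    (hM : ∀ n, p n ≤ M) {a : ℕ → ℝ} (ha : ∀ n, 0 ≤ a n) (hs : Summable a) {N : ℕ} {v : ℕ → H}
    (hv : ∀ n < N, ∀ m < N, |inner ℝ (v n) (v m)| ≤ a (Nat.dist n m)) :
    ‖∑ n ∈ range N, p n • v n‖ ^ 2 ≤ M * (2 * ∑' j, a j) := by
  have hM0 : 0 ≤ M := (hp.nonneg 0).trans (hM 0)
  have hA : 0 ≤ ∑' j, a j := tsum_nonneg ha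
  rw [← real_inner_self_eq_norm_sq, sum_inner]
  calc ∑ n ∈ range N, inner ℝ (p n • v n) (∑ m ∈ range N, p m • v m)
      ≤ ∑ n ∈ range N, p n * (M * (2 * ∑' j, a j)) := by
        refine sum_le_sum fun n hn => ?_
        rw [real_inner_smul_left, inner_sum]
        refine mul_le_mul_of_nonneg_left ?_ (hp.nonneg n)
        calc ∑ m ∈ range N, inner ℝ (v n) (p m • v m)
            ≤ ∑ m ∈ range N, M * a (Nat.dist n m) := by
              refine sum_le_sum fun m hm => ?_
              rw [real_inner_smul_right]
              refine (mul_le_mul_of_nonneg_left ((le_abs_self _).trans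
                (hv n (mem_range.1 hn) m (mem_range.1 hm))) (hp.nonneg m)).trans ?_
              exact mul_le_mul_of_nonneg_right (hM m) (ha _)
          _ ≤ M * (2 * ∑' j, a j) := by
              rw [← mul_sum]
              exact mul_le_mul_of_nonneg_left (sum_dist_le ha hs n N) hM0
    _ ≤ M * (2 * ∑' j, a j) := by
        rw [← sum_mul]
        exact mul_le_of_le_one_left (by positivity) (hp.sum_le N)

theorem inner_pow_apply_pow_apply {P : H →L[ℝ] H} (hP : ∀ x, ‖P x‖ = ‖x‖) (n : ℕ) (x y : H) :
    inner ℝ ((P ^ n) x) ((P ^ n) y) = inner ℝ x y := by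
  induction n with
  | zero => simp
  | succ n ih =>
    rw [pow_succ', mul_apply_eq_comp, mul_apply_eq_comp, ← ih]
    exact (⟨P.toLinearMap, hP⟩ : H →ₗᵢ[ℝ] H).inner_map_map _ _

theorem abs_inner_pow_apply_le {P : H →L[ℝ] H} (hP : ∀ x, ‖P x‖ = ‖x‖) {f : H} {a : ℕ → ℝ}
    (hf : ∀ k, |inner ℝ f ((P ^ k) f)| ≤ a k) (n m : ℕ) :
    |inner ℝ ((P ^ n) f) ((P ^ m) f)| ≤ a (Nat.dist n m) := by
  wlog h : n ≤ m generalizing n m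
  · rw [real_inner_comm, Nat.dist_comm]
    exact this m n (le_of_not_ge h)
  obtain ⟨k, rfl⟩ := Nat.exists_eq_add_of_le h
  rw [pow_add, mul_apply_eq_comp, inner_pow_apply_pow_apply hP, Nat.dist_eq_sub_of_le h,
    Nat.add_sub_cancel_left]
  exact hf k

theorem norm_sq_le_of_hasSum {E : Type*} [NormedAddCommGroup E] {v : ℕ → E} {g : E} (hg : HasSum v g) {B : ℝ}
    (hB : ∀ N, ‖∑ n ∈ range N, v n‖ ^ 2 ≤ B) : ‖g‖ ^ 2 ≤ B :=
  le_of_tendsto (hg.tendsto_sum_nat.norm.pow 2) (Filter.Eventually.of_forall hB)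

variable [CompleteSpace H]

theorem IsSubprobability.summable_smul_pow {Q : H →L[ℝ] H} (hQ : ‖Q‖ ≤ 1) {p : ℕ → ℝ}
    (hp : IsSubprobability p) (f : H) : Summable fun n => p n • (Q ^ n) f := by
  refine Summable.of_norm_bounded (g := fun n => p n * ‖f‖) (hp.summable.mul_right _) fun n => ?_
  rw [norm_smul, Real.norm_of_nonneg (hp.nonneg n)]
  exact mul_le_mul_of_nonneg_left (norm_pow_apply_le hQ n f) (hp.nonneg n)

/-- The recursion for the weights says that the sum `u` of the new series solves `(μ + 1 - Q) u = μ
g`, and `μ + 1 - Q` is invertible. -/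
theorem hasSum_smul_resolvent {Q : H →L[ℝ] H} (hQ : ‖Q‖ ≤ 1) {μ : ℝ} (hμ : 0 < μ) {p : ℕ → ℝ}
    (hp : IsSubprobability p) {f g : H} (hg : HasSum (fun n => p n • (Q ^ n) f) g) :
    HasSum (fun n => resolventStep μ p n • (Q ^ n) f) (μ • resolvent (1 - Q) μ g) := by
  set q := resolventStep μ p with hq
  obtain ⟨u, hu⟩ := (hp.resolventStep hμ).summable_smul_pow hQ f
  rw [← hq] at hu
  have h1 : HasSum (fun n => (μ + 1) • (q (n + 1) • (Q ^ (n + 1)) f))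
      ((μ + 1) • (u - q 0 • f)) := by
    have := (hasSum_nat_add_iff' 1).2 hu
    simp only [sum_range_one, pow_zero, one_apply_eq_self] at this
    exact this.const_smul _
  have h2 : HasSum (fun n => q n • (Q ^ (n + 1)) f) (Q u) := by
    have := Q.hasSum hu
    simpa only [map_smul, pow_succ', mul_apply_eq_comp] using this
  have h3 : HasSum (fun n => μ • (p (n + 1) • (Q ^ (n + 1)) f)) (μ • (g - p 0 • f)) := by
    have := (hasSum_nat_add_iff' 1).2 hg
    simp only [sum_range_one, pow_zero, one_apply_eq_self] at this
    exact this.const_smul _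
  have h4 : (μ + 1) • (u - q 0 • f) = μ • (g - p 0 • f) + Q u := by
    refine h1.unique ?_
    convert h3.add h2 using 2 with n
    rw [smul_smul, smul_smul, ← add_smul, resolventStep_succ_eq hμ]
  have h5 : (μ • (1 : H →L[ℝ] H) + (1 - Q)) u = μ • g := by
    rw [smul_sub, smul_sub, smul_smul, smul_smul, resolventStep_zero_eq hμ] at h4
    have h6 : (μ + 1) • u = μ • g + Q u := by
      rw [sub_add_eq_add_sub] at h4
      exact sub_left_injective h4
    simp only [add_apply, sub_apply, smul_apply, one_apply_eq_self]
    rw [add_smul, one_smul] at h6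
    rw [← add_sub_assoc, h6, add_sub_cancel_right]
  have h6 : μ • resolvent (1 - Q) μ g = u := by
    rw [← map_smul, ← h5, resolvent, ← mul_apply_eq_comp,
      Ring.inverse_mul_cancel _ (isUnit_of_contraction Q hQ hμ), one_apply_eq_self]
  rwa [h6]

theorem hasSum_iter {Q : H →L[ℝ] H} (hQ : ‖Q‖ ≤ 1) {μ : ℕ → ℝ} (hμ : ∀ k, 0 < μ k) (f : H)
    (k : ℕ) : HasSum (fun n => iterWeight μ k n • (Q ^ n) f) (iter (1 - Q) μ f k) := by
  induction k with
  | zero =>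
    refine hasSum_smul_resolvent hQ (hμ 0) IsSubprobability.single ?_
    convert hasSum_single 0 fun n hn => ?_ using 1
    · simp
    · simp [hn]
  | succ k ih => exact hasSum_smul_resolvent hQ (hμ (k + 1)) (isSubprobability_iterWeight hμ k) ih

theorem adjoint_pow_apply_pow_apply {P : H →L[ℝ] H} (hP : ∀ x, ‖P x‖ = ‖x‖) (n : ℕ) (x : H) :
    (ContinuousLinearMap.adjoint P ^ n) ((P ^ n) x) = x := by
  refine ext_inner_right ℝ fun y => ?_
  rw [← ContinuousLinearMap.star_eq_adjoint, ← star_pow, ContinuousLinearMap.star_eq_adjoint,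
    ContinuousLinearMap.adjoint_inner_left, inner_pow_apply_pow_apply hP]

theorem norm_iter_sq_le {P : H →L[ℝ] H} (hP : ∀ x, ‖P x‖ = ‖x‖) {μ : ℕ → ℝ} (hμ : ∀ k, 0 < μ k)
    {f : H} {a : ℕ → ℝ} (ha : ∀ n, 0 ≤ a n) (hs : Summable a)
    (hf : ∀ k, |inner ℝ f ((P ^ k) f)| ≤ a k) {k : ℕ} {M : ℝ}
    (hM : ∀ n, iterWeight μ k n ≤ M) : ‖iter (1 - P) μ f k‖ ^ 2 ≤ M * (2 * ∑' j, a j) := by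
  have hP1 : ‖P‖ ≤ 1 := P.opNorm_le_bound zero_le_one fun x => by rw [hP, one_mul]
  exact norm_sq_le_of_hasSum (hasSum_iter hP1 hμ f k) fun N =>
    (isSubprobability_iterWeight hμ k).norm_sum_smul_sq_le hM ha hs
      fun n _ m _ => abs_inner_pow_apply_le hP hf n m

theorem norm_iter_adjoint_sq_le {P : H →L[ℝ] H} (hP : ∀ x, ‖P x‖ = ‖x‖) {μ : ℕ → ℝ}
    (hμ : ∀ k, 0 < μ k) {f : H} {a : ℕ → ℝ} (ha : ∀ n, 0 ≤ a n) (hs : Summable a)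
    (hf : ∀ k, |inner ℝ f ((P ^ k) f)| ≤ a k) {k : ℕ} {M : ℝ}
    (hM : ∀ n, iterWeight μ k n ≤ M) :
    ‖iter (1 - ContinuousLinearMap.adjoint P) μ f k‖ ^ 2 ≤ M * (2 * ∑' j, a j) := by
  have hP1 : ‖P‖ ≤ 1 := P.opNorm_le_bound zero_le_one fun x => by rw [hP, one_mul]
  have hQ : ‖ContinuousLinearMap.adjoint P‖ ≤ 1 := by rwa [LinearIsometryEquiv.norm_map]
  refine norm_sq_le_of_hasSum (hasSum_iter hQ hμ f k) fun N => ?_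
  set Q := ContinuousLinearMap.adjoint P
  -- Since `P* P = 1`, `P*ⁿ f = P*ᴺ Pᴺ⁻ⁿ f` for `n < N`. The contraction `P*ᴺ` factors out, and `n ↦
  -- N - n` preserves distances.
  have hsum : ∑ n ∈ range N, iterWeight μ k n • (Q ^ n) f
      = (Q ^ N) (∑ n ∈ range N, iterWeight μ k n • (P ^ (N - n)) f) := by
    rw [map_sum]
    refine sum_congr rfl fun n hn => ?_
    obtain ⟨j, rfl⟩ := Nat.exists_eq_add_of_le (mem_range.1 hn).le
    rw [map_smul, Nat.add_sub_cancel_left, pow_add Q, mul_apply_eq_comp,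
      adjoint_pow_apply_pow_apply hP]
  rw [hsum]
  refine (pow_le_pow_left₀ (norm_nonneg _) (norm_pow_apply_le hQ N _) 2).trans ?_
  refine (isSubprobability_iterWeight hμ k).norm_sum_smul_sq_le hM ha hs fun n hn m hm => ?_
  have hd : Nat.dist n m = Nat.dist (N - n) (N - m) := by
    simp only [Nat.dist]
    omega
  rw [hd]
  exact abs_inner_pow_apply_le hP hf _ _

end Hilbert

/-! ### Application to the transition operator -/

theorem abs_inner_iter_add_le {X : Type*} [MeasurableSpace X] {ℙ : Measure X} (T : X → X)
    (hT : MeasurePreserving T ℙ ℙ) {f : Lp ℝ 2 ℙ} {a : ℕ → ℝ} (ha : ∀ n, 0 ≤ a n)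
    (hs : Summable a) (hf : ∀ k, |inner ℝ f ((transition T hT ^ k) f)| ≤ a k) {μ : ℕ → ℝ}
    (hμ : ∀ k, 0 < μ k) {k : ℕ} {M : ℝ} (hM : ∀ n, iterWeight μ k n ≤ M) :
    |inner ℝ (iter (ContinuousLinearMap.adjoint (generator T hT)) μ f k)
        (iter (ContinuousLinearMap.adjoint (generator T hT)) μ f k)|
      + |inner ℝ (iter (generator T hT) μ f k) (iter (generator T hT) μ f k)|
      ≤ 4 * (∑' j, a j) * M := by
  have hP : ∀ x, ‖transition T hT x‖ = ‖x‖ :=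
    (Lp.compMeasurePreservingₗᵢ ℝ T hT).norm_map
  have hadj : ContinuousLinearMap.adjoint (generator T hT)
      = 1 - ContinuousLinearMap.adjoint (transition T hT) := by
    simp only [generator, ← ContinuousLinearMap.star_eq_adjoint, star_sub, star_one]
  rw [real_inner_self_eq_norm_sq, real_inner_self_eq_norm_sq, abs_of_nonneg (sq_nonneg _),
    abs_of_nonneg (sq_nonneg _), hadj, generator]
  linarith [norm_iter_sq_le hP hμ ha hs hf hM, norm_iter_adjoint_sq_le hP hμ ha hs hf hM]

end

end DynSys

theorem proposition5p1 (α : ℝ) (hα : 1 < α) :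
    ∃ C : ℝ, ∀ (X : Type*) [MeasurableSpace X] (ℙ : Measure X) [IsProbabilityMeasure ℙ]
      (T : X → X) (hT : MeasurePreserving T ℙ ℙ) (f : Lp ℝ 2 ℙ),
      (∀ k : ℕ, |inner ℝ f ((DynSys.transition T hT ^ k) f)| ≤ (1 + (k : ℝ)) ^ (-α)) →
      -- constant step sizes
      (∀ k : ℕ,
        |inner ℝ
            (DynSys.iter (ContinuousLinearMap.adjoint (DynSys.generator T hT)) (fun _ => 1) f k)
            (DynSys.iter (ContinuousLinearMap.adjoint (DynSys.generator T hT)) (fun _ => 1) f k)|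
          + |inner ℝ (DynSys.iter (DynSys.generator T hT) (fun _ => 1) f k)
            (DynSys.iter (DynSys.generator T hT) (fun _ => 1) f k)|
          ≤ C * (1 + (k : ℝ)) ^ (-(1 / 2) : ℝ)) ∧
      -- geometric step sizes
      (∀ k : ℕ,
        |inner ℝ
            (DynSys.iter (ContinuousLinearMap.adjoint (DynSys.generator T hT))
              (fun j => (2 : ℝ) ^ (-(j : ℤ))) f k)
            (DynSys.iter (ContinuousLinearMap.adjoint (DynSys.generator T hT))
              (fun j => (2 : ℝ) ^ (-(j : ℤ))) f k)|
          + |inner ℝ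
            (DynSys.iter (DynSys.generator T hT) (fun j => (2 : ℝ) ^ (-(j : ℤ))) f k)
            (DynSys.iter (DynSys.generator T hT) (fun j => (2 : ℝ) ^ (-(j : ℤ))) f k)|
          ≤ C * (2 : ℝ) ^ (-(k : ℤ))) := by
  have hs : Summable fun j : ℕ => (1 + (j : ℝ)) ^ (-α) := by
    have h := (summable_nat_add_iff 1).2 (Real.summable_nat_rpow.2 (by linarith : -α < -1))
    simpa only [Nat.cast_add, Nat.cast_one, add_comm] using h
  have ha : ∀ j : ℕ, 0 ≤ (1 + (j : ℝ)) ^ (-α) := fun j => by positivity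
  refine ⟨4 * ∑' j : ℕ, (1 + (j : ℝ)) ^ (-α), fun X _ ℙ _ T hT f hf => ⟨fun k => ?_, fun k => ?_⟩⟩
  · exact DynSys.abs_inner_iter_add_le T hT ha hs hf (fun _ => one_pos)
      (DynSys.iterWeight_one_le k)
  · have hμ : ∀ j : ℕ, (0 : ℝ) < (2 : ℝ) ^ (-(j : ℤ)) := fun j => by positivity
    exact DynSys.abs_inner_iter_add_le T hT ha hs hf hμ (DynSys.iterWeight_le hμ k)
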